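/- Let $F_2$ be the free group with basis $\{a,b\}$ and let $\mathrm{Aut}\,F_2$ be its automorphism group, with product the composition of maps, $(\sigma\tau)(u)=\sigma(\tau(u))$. For $x,y\in F_2$ let $\varphi_{x,y}$ be the endomorphism of $F_2$ with $a\mapsto x$, $b\mapsto y$. For $X,Y\subseteq \mathrm{Aut}\,F_2$ let $XY=\{\sigma\tau : \sigma\in X,\ \tau\in Y\}$, $X^{-1}=\{\sigma^{-1}:\sigma\in X\}$, and let $X^*$ be the submonoid generated by $X$; a single automorphism is identified with the corresponding singleton set. Consider the following sets of automorphisms of $F_2$: - $\Lambda=\{\lambda_w : w\in F_2\}$, where $\lambda_w(u)=w^{-1}uw$; - $\Psi=\{\varphi\in\mathrm{Aut}\,F_2 : |\varphi(a)|=|\varphi(b)|=1\}$, where $|\cdot|$ is the length of the reduced word; - $\Phi=\{\varphi_{a,ba},\ \varphi_{ab,b},\ \varphi_{a,ab},\ \varphi_{ba,b}\}$; - $\Delta=\{\varphi_{a,a^m b^{\epsilon} a^n} : m,n\in\mathbb{Z},\ \epsilon\in\{1,-1\}\}$; - $\Sigma_0=\{\varphi_{a,ba},\ \varphi_{b^{-1},a^{-1}}\}$.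 Then $$\mathrm{Aut}\,F_2=\Lambda\Psi\Phi^*\Delta=\Psi(\Sigma_0^{-1})^*\Lambda\,\varphi_{a,ba}^*\,(\varphi_{a^{-1},b}\cup\varphi_{a^{-1},b^{-1}}).$$ -/

import Mathlib

open scoped Pointwise

namespace AutF2

/-- The free group of rank two. -/
abbrev F2 : Type := FreeGroup (Fin 2)

/-- The first letter of the basis of `F2`. -/
def a : F2 := FreeGroup.of 0

/-- The second letter of the basis of `F2`. -/
def b : F2 := FreeGroup.of 1

/-- The endomorphism of `F2` that maps `a` to `x` and `b` to `y`. -/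
def phi (x y : F2) : F2 →* F2 := FreeGroup.lift ![x, y]

/-- The set of automorphisms of `F2` whose underlying endomorphism lies in `S`.
The product in `MulAut F2` is composition, `(σ * τ) u = σ (τ u)`. -/
def auts (S : Set (F2 →* F2)) : Set (MulAut F2) :=
  {θ | θ.toMonoidHom ∈ S}

/-- The inner automorphism `u ↦ w⁻¹ * u * w`. -/
def lam (w : F2) : MulAut F2 := MulAut.conj w⁻¹

/-- The set `Λ` of all inner automorphisms. -/
def Lam : Set (MulAut F2) := {θ | ∃ w : F2, θ = lam w}

/-- The set `Ψ` of automorphisms that map both letters to reduced words of length one. -/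
def Psi : Set (MulAut F2) := {θ | FreeGroup.norm (θ a) = 1 ∧ FreeGroup.norm (θ b) = 1}

/-- The set `Σ₀`. -/
def Sigma0 : Set (MulAut F2) := auts {phi a (b * a), phi b⁻¹ a⁻¹}

/-- The set `Φ`. -/
def Phi : Set (MulAut F2) :=
  auts {phi a (b * a), phi (a * b) b, phi a (a * b), phi (b * a) b}

/-- The set `Δ`. -/
def Delta : Set (MulAut F2) :=
  auts {f | ∃ m n ε : ℤ, (ε = 1 ∨ ε = -1) ∧ f = phi a (a ^ m * b ^ ε * a ^ n)}

/-- `X^*`: the set of all finite products, the empty one included, of elements of `X`. -/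
def star (X : Set (MulAut F2)) : Set (MulAut F2) := (Submonoid.closure X : Set (MulAut F2))

end AutF2

/-! The proof is Nielsen reduction modulo inner automorphisms, followed by a word calculation in
`Out F2`. Reduction: let θ be such that no Nielsen move on a pair of letters, followed by a common
conjugation, lowers |θ(a)| + |θ(b)|. Then the images of the letters form a Nielsen reduced family:
at most half of a factor cancels against a neighbour, and something always survives in the middle.
Hence every factor of a reduced product is at most as long as the product (`norm_le_norm_prod`). If
one basis image had length at least 2, the preimages of `a` and `b` would be powers of the other
basis element and would commute. So θ lies in `Psi` (`mem_Psi_of_minimal`). Allowing conjugation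
settles the tie case, where exactly half cancels on both sides, without a well-order on words
(`exists_conj_norm_lt`). By induction on total length, `Psi` and the elementary automorphisms
generate `Out F2` (`exists_toOut_eq`). Calculation: the products ψ φ u^k g, with φ a positive word
in the transvections u, l and g ∈ {1, e}, are stable under right multiplication by the generators
(`OutRelations.factors_mul`); the key relation is l u⁻¹ = u s e. This gives the first factorization.
Conjugating by e c inverts u and l, which gives the second. Inner automorphisms form a normal
subgroup, so the error made by working in `Out F2` can be placed wherever `Lam` stands. -/

namespace AutF2

/-! ### Word length and cancellation in free groups. -/

section Length

variable {α : Type*} [DecidableEq α]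

/-- The length of the longest common prefix of two lists. -/
def lcp {β : Type*} [DecidableEq β] : List β → List β → ℕ
  | x :: s, y :: t => if x = y then lcp s t + 1 else 0
  | _, _ => 0

/-- The ultrametric inequality for common prefixes; it replaces explicit decompositions of words
throughout. -/
theorem min_lcp_le {β : Type*} [DecidableEq β] (r s t : List β) :
    min (lcp r s) (lcp s t) ≤ lcp r t := by
  induction r generalizing s t with
  | nil => cases s <;> simp [lcp]
  | cons x r ih =>
    cases s with
    | nil => simp [lcp]
    | cons y s =>
      cases t with
      | nil => simp [lcp]
      | cons z t =>
        have := ih s t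
        simp only [lcp]
        split_ifs <;> grind

theorem norm_mk_of_isReduced {L : List (α × Bool)} (h : FreeGroup.IsReduced L) :
    (FreeGroup.mk L).norm = L.length := by
  simp [FreeGroup.norm, h.reduce_eq]

theorem isReduced_invRev {L : List (α × Bool)} (h : FreeGroup.IsReduced L) :
    FreeGroup.IsReduced (FreeGroup.invRev L) := by
  rw [FreeGroup.isReduced_iff_reduce_eq] at h ⊢
  rw [FreeGroup.reduce_invRev, h]

/-- Equal first letters cancel; once the first letters differ, the inverse of one word followed by
the other is already reduced. -/
theorem norm_inv_mk_mul_mk {L M : List (α × Bool)} (hL : FreeGroup.IsReduced L)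
    (hM : FreeGroup.IsReduced M) :
    ((FreeGroup.mk L)⁻¹ * FreeGroup.mk M).norm + 2 * lcp L M = L.length + M.length := by
  induction L generalizing M with
  | nil =>
    have : (FreeGroup.mk ([] : List (α × Bool))) = 1 := rfl
    simp [lcp, norm_mk_of_isReduced hM, this]
  | cons x L ih =>
    cases M with
    | nil =>
      have : (FreeGroup.mk ([] : List (α × Bool))) = 1 := rfl
      rw [this, mul_one, FreeGroup.norm_inv_eq, norm_mk_of_isReduced hL]
      simp [lcp]
    | cons y M =>
      by_cases hxy : x = y
      · subst hxy
        have key : (FreeGroup.mk (x :: L))⁻¹ * FreeGroup.mk (x :: M) =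
            (FreeGroup.mk L)⁻¹ * FreeGroup.mk M := by
          have h : ∀ K : List (α × Bool),
              FreeGroup.mk (x :: K) = FreeGroup.mk [x] * FreeGroup.mk K := fun K => by
            rw [FreeGroup.mul_mk]; rfl
          rw [h L, h M]; group
        have := ih (hL.infix ⟨[x], [], by simp⟩) (hM.infix (L₁ := M) ⟨[x], [], by simp⟩)
        rw [key]
        simp only [lcp, if_true, List.length_cons]
        omega
      · have hred : FreeGroup.IsReduced (FreeGroup.invRev (x :: L) ++ (y :: M)) := by
          have e : FreeGroup.invRev (x :: L) = FreeGroup.invRev L ++ [(x.1, !x.2)] := by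
            simp [FreeGroup.invRev]
          rw [e]
          refine FreeGroup.IsReduced.append_overlap ?_ ?_ (by simp)
          · rw [← e]; exact isReduced_invRev hL
          · rw [List.singleton_append, FreeGroup.isReduced_cons_cons]
            refine ⟨fun h1 => ?_, hM⟩
            obtain ⟨x1, x2⟩ := x
            obtain ⟨y1, y2⟩ := y
            cases x2 <;> cases y2 <;> simp_all
        rw [FreeGroup.inv_mk, FreeGroup.mul_mk, norm_mk_of_isReduced hred]
        simp [lcp, hxy]

/-- The length of the longest common prefix of the reduced words of two elements. -/
def cp (g h : FreeGroup α) : ℕ := lcp g.toWord h.toWord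

theorem norm_inv_mul_add (g h : FreeGroup α) :
    (g⁻¹ * h).norm + 2 * cp g h = g.norm + h.norm := by
  have := norm_inv_mk_mul_mk (FreeGroup.isReduced_toWord (x := g))
    (FreeGroup.isReduced_toWord (x := h))
  rwa [FreeGroup.mk_toWord, FreeGroup.mk_toWord] at this

theorem min_cp_le (g h k : FreeGroup α) : min (cp g h) (cp h k) ≤ cp g k :=
  min_lcp_le _ _ _

theorem cp_comm (g h : FreeGroup α) : cp g h = cp h g := by
  have h1 := norm_inv_mul_add g h
  have h2 := norm_inv_mul_add h g
  have : (g⁻¹ * h).norm = (h⁻¹ * g).norm := by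
    rw [← FreeGroup.norm_inv_eq]; simp
  omega

theorem exists_prefix (g : FreeGroup α) {k : ℕ} (hk : k ≤ g.norm) :
    ∃ q : FreeGroup α, q.norm = k ∧ cp q g = k := by
  have hred := FreeGroup.isReduced_toWord (x := g)
  have h1 : FreeGroup.IsReduced (g.toWord.take k) :=
    hred.infix (List.take_prefix _ _).isInfix
  have h2 : FreeGroup.IsReduced (g.toWord.drop k) :=
    hred.infix (List.drop_suffix _ _).isInfix
  have hn : (FreeGroup.mk (g.toWord.take k)).norm = k := by
    rw [norm_mk_of_isReduced h1, List.length_take]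
    exact min_eq_left hk
  refine ⟨FreeGroup.mk (g.toWord.take k), hn, ?_⟩
  have h3 := norm_inv_mul_add (FreeGroup.mk (g.toWord.take k)) g
  have h4 : g = FreeGroup.mk (g.toWord.take k) * FreeGroup.mk (g.toWord.drop k) := by
    rw [FreeGroup.mul_mk, List.take_append_drop, FreeGroup.mk_toWord]
  have h5 : (FreeGroup.mk (g.toWord.take k))⁻¹ * g = FreeGroup.mk (g.toWord.drop k) := by
    rw [inv_mul_eq_iff_eq_mul]; exact h4
  rw [h5, norm_mk_of_isReduced h2, List.length_drop, hn] at h3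
  have : g.toWord.length = g.norm := rfl
  omega

/-- Write g = c r c⁻¹ with r cyclically reduced and nonempty; the reduced word of g² is c r r c⁻¹.
-/
theorem norm_lt_norm_mul_self {g : FreeGroup α} (hg : g ≠ 1) : g.norm < (g * g).norm := by
  have hred := FreeGroup.isReduced_toWord (x := g)
  have h2 := FreeGroup.toWord_pow g 2
  rw [FreeGroup.reduceCyclically.reduce_flatten_replicate_succ hred 1] at h2
  have h1 := FreeGroup.reduceCyclically.conj_conjugator_reduceCyclically g.toWord
  have h3 : FreeGroup.reduceCyclically g.toWord ≠ [] := by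
    intro h
    rw [h] at h1
    apply hg
    have := congrArg FreeGroup.mk h1
    rw [FreeGroup.mk_toWord, ← FreeGroup.mul_mk, ← FreeGroup.mul_mk, ← FreeGroup.inv_mk] at this
    rw [← this, ← FreeGroup.one_eq_mk, mul_one, mul_inv_cancel]
  have h4 := congrArg List.length h1
  have h5 := congrArg List.length h2
  have h6 := List.length_pos_iff.mpr h3
  rw [pow_two] at h5
  simp [List.replicate_succ] at h4 h5
  change g.toWord.length < (g * g).toWord.length
  omega

end Length

/-- The inverse letter. -/
def neg {β : Type*} (l : β × Bool) : β × Bool := (l.1, !l.2)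

@[simp] theorem neg_neg {β : Type*} (l : β × Bool) : neg (neg l) = l := by simp [neg]

/-! ### Nielsen reduced families. -/

section Nielsen

variable {α : Type*} [DecidableEq α]

theorem cp_self (g : FreeGroup α) : cp g g = g.norm := by
  have := norm_inv_mul_add g g
  simp at this
  omega

/-- In a Nielsen reduced family, every factor of a reduced product is at most as long as the
product. -/
theorem norm_le_norm_prod {β : Type*} (z : β × Bool → FreeGroup α)
    (zneg : ∀ l, z (neg l) = (z l)⁻¹) (z1 : ∀ l, z l ≠ 1)
    (h1 : ∀ p l, p ≠ l → 2 * cp (z p) (z l) ≤ (z p).norm ∧ 2 * cp (z p) (z l) ≤ (z l).norm)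
    (h2 : ∀ p l q, p ≠ l → q ≠ neg l → cp (z p) (z l) + cp (z (neg l)) (z q) < (z l).norm)
    (l : β × Bool) (L : List (β × Bool)) (hL : FreeGroup.IsReduced (l :: L)) :
    (∀ m ∈ l :: L, (z m).norm ≤ ((l :: L).map z).prod.norm) ∧
      ∀ p, p ≠ l → cp (z p) (z l) < cp (z l) ((l :: L).map z).prod := by
  induction L generalizing l with
  | nil =>
    simp only [List.map_cons, List.map_nil, List.prod_cons, List.prod_nil, mul_one,
      List.mem_singleton, forall_eq, le_refl, true_and, cp_self]
    intro p hp
    have := (h1 p l hp).2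
    have h0 : (z l).norm ≠ 0 := by simpa using z1 l
    omega
  | cons k L ih =>
    rw [FreeGroup.isReduced_cons_cons] at hL
    obtain ⟨ih1, ih2⟩ := ih k hL.2
    rw [List.map_cons, List.prod_cons]
    set w := ((k :: L).map z).prod
    have hne : neg l ≠ k := by
      rintro rfl
      simp [neg] at hL
    -- The second clause of the induction hypothesis makes z(l)⁻¹ part from `z k` inside the prefix
    -- that `z k` shares with `w`. By the ultrametric inequality, z(l) then cancels against `w`
    -- exactly as much as against `z k`, at most half of each.
    have e1 := ih2 _ hne
    have e2 := min_cp_le (z (neg l)) (z k) w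
    have e3 := min_cp_le (z (neg l)) w (z k)
    rw [cp_comm w] at e3
    have e4 := norm_inv_mul_add (z (neg l)) w
    rw [zneg, inv_inv, ← zneg, zneg, FreeGroup.norm_inv_eq, ← zneg] at e4
    have e5 := norm_inv_mul_add (z l) (z l * w)
    rw [inv_mul_cancel_left] at e5
    have e6 := h1 _ _ hne
    have e7 : (z (neg l)).norm = (z l).norm := by rw [zneg, FreeGroup.norm_inv_eq]
    have e8 := ih1 k (by simp)
    refine ⟨?_, fun p hp => ?_⟩
    · intro m hm
      rcases List.mem_cons.mp hm with rfl | hm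
      · omega
      · have := ih1 m hm
        omega
    · have := h2 p l k hp hne.symm
      omega

/-- The hypotheses say x = p q⁻¹ with halves of equal length k, where y begins with q and ends with
p⁻¹. Conjugation by q⁻¹ turns x into q⁻¹p, of length at most 2k, and yx into q⁻¹yp, which has lost
2k letters of y. -/
theorem exists_conj_norm_lt {x y : FreeGroup α} (h1 : 2 * cp y⁻¹ x = x.norm)
    (h2 : 2 * cp x⁻¹ y = x.norm) (hxy : x.norm ≤ y.norm) (hx : x ≠ 1) :
    ∃ q, (q * x * q⁻¹).norm + (q * (y * x) * q⁻¹).norm < x.norm + y.norm := by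
  have hx0 : x.norm ≠ 0 := by simpa using hx
  obtain ⟨k, hk⟩ : ∃ k, x.norm = 2 * k := ⟨_, h1.symm⟩
  obtain ⟨q, hq, hqy⟩ := exists_prefix y (k := k) (by omega)
  have a1 : k ≤ cp q x⁻¹ := by
    have := min_cp_le q y x⁻¹
    rw [cp_comm y] at this
    omega
  have a2 : (x * q).norm + 2 * cp x⁻¹ q = x.norm + k := by
    have := norm_inv_mul_add x⁻¹ q
    rwa [inv_inv, FreeGroup.norm_inv_eq, hq] at this
  rw [cp_comm] at a2
  have a3 : (q⁻¹ * x * q).norm ≤ k + (x * q).norm := by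
    have := FreeGroup.norm_mul_le q⁻¹ (x * q)
    rwa [← mul_assoc, FreeGroup.norm_inv_eq, hq] at this
  have a4 : x.norm ≤ (x * q).norm + k := by
    have := FreeGroup.norm_mul_le (x * q) q⁻¹
    rwa [mul_inv_cancel_right, FreeGroup.norm_inv_eq, hq] at this
  have b1 : (q⁻¹).norm + 2 * cp (x * q) x = (x * q).norm + x.norm := by
    have := norm_inv_mul_add (x * q) x
    rwa [mul_inv_rev, inv_mul_cancel_right] at this
  rw [FreeGroup.norm_inv_eq] at b1
  have b2 : k ≤ cp (x * q) y⁻¹ := by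
    have := min_cp_le (x * q) x y⁻¹
    rw [cp_comm x] at this
    omega
  have b3 : (y * (x * q)).norm + 2 * cp y⁻¹ (x * q) = y.norm + (x * q).norm := by
    have := norm_inv_mul_add y⁻¹ (x * q)
    rwa [inv_inv, FreeGroup.norm_inv_eq] at this
  rw [cp_comm] at b3
  have b4 : y.norm ≤ (y * (x * q)).norm + (x * q).norm := by
    have := FreeGroup.norm_mul_le (y * (x * q)) (x * q)⁻¹
    rwa [mul_inv_cancel_right, FreeGroup.norm_inv_eq] at this
  have c1 : (x * q).norm + 2 * cp y (y * (x * q)) = y.norm + (y * (x * q)).norm := by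
    have := norm_inv_mul_add y (y * (x * q))
    rwa [inv_mul_cancel_left] at this
  have c2 := min_cp_le q y (y * (x * q))
  have c3 := norm_inv_mul_add q (y * (x * q))
  refine ⟨q⁻¹, ?_⟩
  have d1 : q⁻¹ * x * q⁻¹⁻¹ = q⁻¹ * x * q := by simp
  have d2 : q⁻¹ * (y * x) * q⁻¹⁻¹ = q⁻¹ * (y * (x * q)) := by simp [mul_assoc]
  rw [d1, d2]
  omega

end Nielsen

/-! ### Minimal automorphisms permute the letters. -/

section Reduction

/-- The element of `F2` given by a letter. -/
def letter (l : Fin 2 × Bool) : F2 := FreeGroup.mk [l]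

theorem letter_neg (l : Fin 2 × Bool) : letter (neg l) = (letter l)⁻¹ := by
  simp [letter, neg, FreeGroup.invRev]

theorem map_eq_prod (θ : MulAut F2) (L : List (Fin 2 × Bool)) :
    θ (FreeGroup.mk L) = (L.map fun l => θ (letter l)).prod := by
  induction L with
  | nil => exact map_one θ
  | cons l L ih =>
    have : (FreeGroup.mk (l :: L) : F2) = letter l * FreeGroup.mk L := by
      rw [letter, FreeGroup.mul_mk]; rfl
    rw [this, map_mul, ih, List.map_cons, List.prod_cons]

theorem mem_zpowers_of_forall_ne {i j : Fin 2} (hij : i ≠ j) (L : List (Fin 2 × Bool))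
    (h : ∀ l ∈ L, l.1 ≠ i) : FreeGroup.mk L ∈ Subgroup.zpowers (FreeGroup.of j : F2) := by
  induction L with
  | nil => exact one_mem _
  | cons l L ih =>
    have e : (FreeGroup.mk (l :: L) : F2) = letter l * FreeGroup.mk L := by
      rw [letter, FreeGroup.mul_mk]; rfl
    rw [e]
    refine mul_mem ?_ (ih fun m hm => h m (List.mem_cons_of_mem _ hm))
    have h1 : l.1 = j := by
      have := h l (by simp)
      omega
    obtain ⟨l1, l2⟩ := l
    obtain rfl : l1 = j := h1
    cases l2
    · have : letter (l1, false) = (FreeGroup.of l1)⁻¹ := by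
        simp [letter, FreeGroup.of, FreeGroup.invRev]
      rw [this]
      exact inv_mem (Subgroup.mem_zpowers _)
    · exact Subgroup.mem_zpowers _

theorem a_mul_b_ne : a * b ≠ b * a := by
  unfold a b
  decide

/-- An automorphism whose values on the basis cannot be shortened by a Nielsen move followed by a
conjugation maps letters to letters. -/
theorem mem_Psi_of_minimal (θ : MulAut F2)
    (hmin : ∀ l m : Fin 2 × Bool, l.1 ≠ m.1 → ∀ c : F2,
      (θ (letter l)).norm + (θ (letter m)).norm ≤
        (c * θ (letter l) * c⁻¹).norm + (c * (θ (letter m) * θ (letter l)) * c⁻¹).norm) :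
    θ ∈ Psi := by
  set z : Fin 2 × Bool → F2 := fun l => θ (letter l) with hz
  have zneg : ∀ l, z (neg l) = (z l)⁻¹ := fun l => by simp [hz, letter_neg]
  have z1 : ∀ l, z l ≠ 1 := fun l h => by
    have h0 : letter l = 1 := by simpa [hz] using h
    have h3 : (letter l).norm = 1 := norm_mk_of_isReduced FreeGroup.IsReduced.singleton
    simp [h0] at h3
  have hN : ∀ l, (z (neg l)).norm = (z l).norm := fun l => by
    rw [zneg, FreeGroup.norm_inv_eq]
  have key : ∀ l m : Fin 2 × Bool, l.1 ≠ m.1 → (z m).norm ≤ (z m * z l).norm := by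
    intro l m h
    have := hmin l m h 1
    simp only [one_mul, inv_one, mul_one] at this
    change (z l).norm + (z m).norm ≤ (z l).norm + (z m * z l).norm at this
    omega
  -- A nontrivial element shares less than half of its word with its inverse, because its square is
  -- longer than itself.
  have self : ∀ l, 2 * cp (z (neg l)) (z l) < (z l).norm := by
    intro l
    have e1 := norm_inv_mul_add (z (neg l)) (z l)
    have e2 := norm_lt_norm_mul_self (z1 l)
    rw [hN, zneg, inv_inv, ← zneg] at e1
    omega
  have diff : ∀ p l : Fin 2 × Bool, p.1 ≠ l.1 →
      2 * cp (z p) (z l) ≤ (z p).norm ∧ 2 * cp (z p) (z l) ≤ (z l).norm := by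
    intro p l h
    have e1 := norm_inv_mul_add (z p) (z l)
    have e2 := key l (neg p) h.symm
    have e3 := key p (neg l) h
    have e4 : (z (neg l) * z p).norm = ((z p)⁻¹ * z l).norm := by
      rw [← FreeGroup.norm_inv_eq, zneg]; simp
    rw [hN] at e2 e3
    rw [zneg] at e2
    omega
  have cases_eq : ∀ p l : Fin 2 × Bool, p.1 = l.1 → p ≠ l → p = neg l := by decide
  have h1 : ∀ p l, p ≠ l →
      2 * cp (z p) (z l) ≤ (z p).norm ∧ 2 * cp (z p) (z l) ≤ (z l).norm := by
    intro p l h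
    by_cases hp : p.1 = l.1
    · obtain rfl := cases_eq p l hp h
      have := self l
      rw [hN]
      omega
    · exact diff p l hp
  have h2 : ∀ p l q, p ≠ l → q ≠ neg l →
      cp (z p) (z l) + cp (z (neg l)) (z q) < (z l).norm := by
    intro p l q hp hq
    -- If nothing of `z l` survives, both cancellations are exactly half of it. `self` then excludes
    -- `l` and its inverse as neighbours, so `p` and `q` are letters of the other generator.
    by_contra! hcon
    have e1 := h1 p l hp
    have e2 := h1 (neg l) q hq.symm
    rw [hN] at e2
    have hp1 : p.1 ≠ l.1 := fun h => by
      obtain rfl := cases_eq p l h hp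
      have := self l
      omega
    have hq1 : q.1 ≠ l.1 := fun h => by
      obtain rfl : q = l := by
        rw [cases_eq q (neg l) h hq, neg_neg]
      have := self q
      omega
    -- If `p = q`, then `z l` and its inverse would share half of their word through `z p`, against
    -- `self`.
    have hpq : p = neg q := by
      refine cases_eq p q (by omega) ?_
      rintro rfl
      have f1 := min_cp_le (z (neg l)) (z p) (z l)
      have f2 := self l
      omega
    subst hpq
    obtain ⟨c, hc⟩ := exists_conj_norm_lt (x := z l) (y := z q)
      (by rw [← zneg]; omega) (by rw [← zneg]; omega) (by omega) (z1 l)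
    have := hmin l q hq1.symm c
    change (z l).norm + (z q).norm ≤ (c * z l * c⁻¹).norm + (c * (z q * z l) * c⁻¹).norm at this
    omega
  have main : ∀ i j : Fin 2, i ≠ j → (θ (FreeGroup.of i)).norm = 1 := by
    intro i j hij
    by_contra hne
    have hi2 : ∀ l : Fin 2 × Bool, l.1 = i → 2 ≤ (z l).norm := by
      have h3 : (z (i, true)).norm ≠ 1 := hne
      have h4 : (z (i, true)).norm ≠ 0 := by simpa using z1 (i, true)
      have h5 : (z (i, false)).norm = (z (i, true)).norm := hN (i, true)
      have h6 : 2 ≤ (z (i, true)).norm := by omega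
      rintro ⟨l1, l2⟩ rfl
      cases l2
      · exact h6.trans h5.ge
      · exact h6
    -- An element of length 1 is the product of the z-values along the word of its preimage, so no
    -- factor of length at least 2 can occur.
    have mem : ∀ g : F2, g.norm = 1 → θ.symm g ∈ Subgroup.zpowers (FreeGroup.of j : F2) := by
      intro g hg
      have hr := FreeGroup.isReduced_toWord (x := θ.symm g)
      have hw : FreeGroup.mk (θ.symm g).toWord = θ.symm g := FreeGroup.mk_toWord
      have hp := map_eq_prod θ (θ.symm g).toWord
      rw [hw, MulEquiv.apply_symm_apply] at hp
      rw [← hw]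
      refine mem_zpowers_of_forall_ne hij _ fun l hl hli => ?_
      generalize (θ.symm g).toWord = L at hr hp hl
      cases L with
      | nil => simp at hl
      | cons k L =>
        have f1 := (norm_le_norm_prod z zneg z1 h1 h2 k L hr).1 l hl
        rw [← hp, hg] at f1
        have := hi2 l hli
        omega
    have ha := mem a (FreeGroup.norm_of 0)
    have hb := mem b (FreeGroup.norm_of 1)
    obtain ⟨n, hn⟩ := Subgroup.mem_zpowers_iff.mp ha
    obtain ⟨m, hm⟩ := Subgroup.mem_zpowers_iff.mp hb
    apply a_mul_b_ne
    apply θ.symm.injective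
    rw [map_mul, map_mul, ← hn, ← hm, ← zpow_add, ← zpow_add, add_comm]
  exact ⟨main 0 1 (by decide), main 1 0 (by decide)⟩

end Reduction

/-! ### Normal forms from the relations of `Out F2`. -/

section Factorization

/-- Elements `u, l, s, e, c` of a group satisfying the relations between the images in `Out F2` of
the two elementary transvections, the swap, the inversion of the second letter and the inversion
of both letters. -/
structure OutRelations {Q : Type*} [Group Q] (u l s e c : Q) : Prop where
  ss : s * s = 1
  ee : e * e = 1
  cc : c * c = 1
  cu : c * u = u * c
  cs : c * s = s * c
  ce : c * e = e * c
  se : s * e = e * c * s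
  su : s * u = l * s
  eu : e * u = u⁻¹ * e
  lu : l * u⁻¹ = u * (s * e)

variable {Q : Type*} [Group Q] {u l s e c : Q}

/-- The elements with a factorization into an element of `P`, a positive word in `u` and `l`, a
power of `u` and possibly `e`. -/
def Factors (P : Submonoid Q) (u l e x : Q) : Prop :=
  ∃ ψ ∈ P, ∃ φ ∈ Submonoid.closure {u, l}, ∃ k : ℤ, ∃ g, (g = 1 ∨ g = e) ∧ x = ψ * φ * u ^ k * g

namespace OutRelations

variable {P : Submonoid Q}

theorem sl (h : OutRelations u l s e c) : s * l = u * s := by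
  have h1 : l = s * u * s⁻¹ := by rw [h.su]; simp
  have h2 : s⁻¹ = s := inv_eq_of_mul_eq_one_right h.ss
  rw [h1, h2, ← mul_assoc, ← mul_assoc, h.ss, one_mul]

theorem cl (h : OutRelations u l s e c) : c * l = l * c := by
  have h1 : l = s * u * s⁻¹ := by rw [h.su]; simp
  have hcs : Commute c s := h.cs
  have hcu : Commute c u := h.cu
  rw [h1]
  exact (hcs.mul_right hcu).mul_right hcs.inv_right

theorem el (h : OutRelations u l s e c) : e * l = l⁻¹ * e := by
  have h2 : s⁻¹ = s := inv_eq_of_mul_eq_one_right h.ss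
  have h1 : l = s * u * s := by rw [h.su, mul_assoc, h.ss, mul_one]
  have h3 : e * s = s * e * c := by
    have := h.se
    rw [mul_assoc, h.cs, ← mul_assoc] at this
    rw [this, mul_assoc, h.cc, mul_one]
  have hcu : c * u⁻¹ = u⁻¹ * c := (show Commute c u from h.cu).inv_right
  calc e * l = (e * s) * u * s := by rw [h1]; group
    _ = s * e * (c * u) * s := by rw [h3]; group
    _ = s * (e * u) * (c * s) := by rw [h.cu]; group
    _ = s * u⁻¹ * (e * c * s) := by rw [h.eu]; group
    _ = s * u⁻¹ * s * e := by rw [← h.se]; group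
    _ = l⁻¹ * e := by rw [h1, mul_inv_rev, mul_inv_rev, h2]; group

theorem commute_of_mem (h : OutRelations u l s e c) {φ : Q}
    (hφ : φ ∈ Submonoid.closure {u, l}) : Commute c φ := by
  induction hφ using Submonoid.closure_induction with
  | mem x hx =>
    rcases hx with rfl | rfl
    exacts [h.cu, h.cl]
  | one => exact Commute.one_right c
  | mul x y _ _ hx hy => exact hx.mul_right hy

theorem swap_mul (h : OutRelations u l s e c) {φ : Q} (hφ : φ ∈ Submonoid.closure {u, l}) :
    ∃ φ' ∈ Submonoid.closure {u, l}, φ * s = s * φ' := by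
  induction hφ using Submonoid.closure_induction with
  | mem x hx =>
    rcases hx with rfl | rfl
    exacts [⟨l, Submonoid.subset_closure (by simp), h.sl.symm⟩,
      ⟨u, Submonoid.subset_closure (by simp), h.su.symm⟩]
  | one => exact ⟨1, one_mem _, by simp⟩
  | mul x y _ _ hx hy =>
    obtain ⟨x', hx', hx⟩ := hx
    obtain ⟨y', hy', hy⟩ := hy
    exact ⟨x' * y', mul_mem hx' hy', by rw [mul_assoc, hy, ← mul_assoc, hx, mul_assoc]⟩

theorem factors_mul_left {ψ x : Q} (hψ : ψ ∈ P) (hx : Factors P u l e x) :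
    Factors P u l e (ψ * x) := by
  obtain ⟨ψ', hψ', φ, hφ, k, g, hg, rfl⟩ := hx
  exact ⟨ψ * ψ', mul_mem hψ hψ', φ, hφ, k, g, hg, by group⟩

theorem factors_of_mem {φ : Q} (hφ : φ ∈ Submonoid.closure {u, l}) : Factors P u l e φ :=
  ⟨1, one_mem _, φ, hφ, 0, 1, .inl rfl, by simp⟩

theorem factors_mul_e (h : OutRelations u l s e c) {x : Q} (hx : Factors P u l e x) :
    Factors P u l e (x * e) := by
  obtain ⟨ψ, hψ, φ, hφ, k, g, rfl | rfl, rfl⟩ := hx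
  · exact ⟨ψ, hψ, φ, hφ, k, e, .inr rfl, by simp⟩
  · exact ⟨ψ, hψ, φ, hφ, k, 1, .inl rfl, by rw [mul_assoc, h.ee]⟩

theorem factors_mul_c (h : OutRelations u l s e c) (hc : c ∈ P) {x : Q}
    (hx : Factors P u l e x) : Factors P u l e (x * c) := by
  obtain ⟨ψ, hψ, φ, hφ, k, g, hg, rfl⟩ := hx
  refine ⟨ψ * c, mul_mem hψ hc, φ, hφ, k, g, hg, ?_⟩
  have h1 : Commute c g := by
    rcases hg with rfl | rfl
    exacts [Commute.one_right c, h.ce]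
  have h2 : Commute c (u ^ k) := (show Commute c u from h.cu).zpow_right k
  have h3 := ((h.commute_of_mem hφ).mul_right h2).mul_right h1
  calc ψ * φ * u ^ k * g * c = ψ * (φ * u ^ k * g * c) := by group
    _ = ψ * (c * (φ * u ^ k * g)) := by rw [h3.eq]
    _ = _ := by group

theorem factors_mul_u (h : OutRelations u l s e c) {x : Q} (hx : Factors P u l e x) :
    Factors P u l e (x * u) ∧ Factors P u l e (x * u⁻¹) := by
  obtain ⟨ψ, hψ, φ, hφ, k, g, rfl | rfl, rfl⟩ := hx
  · exact ⟨⟨ψ, hψ, φ, hφ, k + 1, 1, .inl rfl, by group⟩,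
      ⟨ψ, hψ, φ, hφ, k - 1, 1, .inl rfl, by group⟩⟩
  · have h1 : g * u⁻¹ = u * g := by
      rw [mul_inv_eq_iff_eq_mul, mul_assoc, h.eu]; group
    exact ⟨⟨ψ, hψ, φ, hφ, k - 1, g, .inr rfl, by rw [mul_assoc, h.eu]; group⟩,
      ⟨ψ, hψ, φ, hφ, k + 1, g, .inr rfl, by rw [mul_assoc, h1]; group⟩⟩

/-- The only hard case of right multiplication: `s` behind a negative power of `u`. The induction
consumes φ from its right end. -/
theorem factors_mul_inv_pow_mul_s (h : OutRelations u l s e c) (hs : s ∈ P) (he : e ∈ P)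
    (hc : c ∈ P) {φ : Q} (hφ : φ ∈ Submonoid.closure {u, l}) (n : ℕ) :
    Factors P u l e (φ * u⁻¹ ^ n * s) := by
  have hl : l ∈ Submonoid.closure {u, l} := Submonoid.subset_closure (by simp)
  have hu : u ∈ Submonoid.closure {u, l} := Submonoid.subset_closure (by simp)
  have zero : ∀ φ ∈ Submonoid.closure {u, l}, Factors P u l e (φ * u⁻¹ ^ 0 * s) := by
    intro φ hφ
    obtain ⟨φ', hφ', e1⟩ := h.swap_mul hφ
    rw [pow_zero, mul_one, e1]
    exact factors_mul_left hs (factors_of_mem hφ')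
  have hes : e * s = s * e * c := by
    have := h.se
    rw [mul_assoc, h.cs, ← mul_assoc] at this
    rw [this, mul_assoc, h.cc, mul_one]
  have hul : SemiconjBy s u l := h.su
  have hlu : SemiconjBy s l u := h.sl
  have heu : SemiconjBy e u⁻¹ u := by
    have : SemiconjBy e u u⁻¹ := h.eu
    simpa using this.inv_right
  induction hφ using Submonoid.closure_induction_right generalizing n with
  | one =>
    -- Moving `s` to the left turns u⁻ⁿ into l⁻ⁿ, and conjugation by `e` makes this power positive.
    have e1 : u⁻¹ ^ n * s = s * (e * (l ^ n * e)) := by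
      have h1 : SemiconjBy e l⁻¹ l := by
        have : SemiconjBy e l l⁻¹ := h.el
        simpa using this.inv_right
      have h2 := h1.pow_right n
      have h3 := hlu.inv_right.pow_right n
      rw [← h2.eq, ← h3.eq, ← mul_assoc e e, h.ee, one_mul]
    rw [one_mul, e1]
    exact factors_mul_left hs (factors_mul_left he (h.factors_mul_e
      (factors_of_mem (pow_mem hl n))))
  | mul_right x hx y hy ih =>
    cases n with
    | zero => exact zero _ (mul_mem hx (Submonoid.subset_closure hy))
    | succ n =>
      rcases hy with rfl | rfl
      · have := ih n
        rwa [pow_succ', ← mul_assoc, mul_inv_cancel_right]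
      -- Here `y` is `l`. One factor u⁻¹ is spent on l u⁻¹ = u s e; the s e so created carries the
      -- remaining u⁻ⁿ to lⁿ, and the two swaps cancel.
      · have h1 : SemiconjBy (s * e) (u⁻¹ ^ n) (y ^ n) :=
          (hul.mul_left heu).pow_right n
        have e1 : x * y * u⁻¹ ^ (n + 1) * s = x * u * y ^ n * e * c := by
          calc x * y * u⁻¹ ^ (n + 1) * s = x * (y * u⁻¹) * u⁻¹ ^ n * s := by
                rw [pow_succ']; group
            _ = x * u * ((s * e) * u⁻¹ ^ n) * s := by rw [h.lu]; group
            _ = x * u * y ^ n * (s * (e * s)) := by rw [h1.eq]; group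
            _ = x * u * y ^ n * ((s * s) * e * c) := by rw [hes]; group
            _ = _ := by rw [h.ss]; group
        rw [e1]
        exact h.factors_mul_c hc (h.factors_mul_e
          (factors_of_mem (mul_mem (mul_mem hx hu) (pow_mem hl n))))

theorem factors_mul_s (h : OutRelations u l s e c) (hs : s ∈ P) (he : e ∈ P)
    (hc : c ∈ P) {x : Q} (hx : Factors P u l e x) : Factors P u l e (x * s) := by
  obtain ⟨ψ, hψ, φ, hφ, k, g, hg, rfl⟩ := hx
  have key : Factors P u l e (φ * u ^ k * s) := by
    obtain ⟨n, rfl | rfl⟩ := k.eq_nat_or_neg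
    · have hu : u ∈ Submonoid.closure {u, l} := Submonoid.subset_closure (by simp)
      have := h.factors_mul_inv_pow_mul_s hs he hc (mul_mem hφ (pow_mem hu n)) 0
      simpa using this
    · have := h.factors_mul_inv_pow_mul_s hs he hc hφ n
      simpa using this
  rcases hg with rfl | rfl
  · have := factors_mul_left hψ key
    simpa [mul_assoc] using this
  · have hes : g * s = s * g * c := by
      have := h.se
      rw [mul_assoc, h.cs, ← mul_assoc] at this
      rw [this, mul_assoc, h.cc, mul_one]
    have := factors_mul_left hψ (h.factors_mul_c hc (h.factors_mul_e key))
    have e1 : ψ * φ * u ^ k * g * s = ψ * (φ * u ^ k * s * g * c) := by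
      rw [mul_assoc _ g s, hes]; group
    rwa [e1]

theorem factors_mul (h : OutRelations u l s e c) (hs : s ∈ P) (he : e ∈ P)
    (hc : c ∈ P) {x g : Q} (hx : Factors P u l e x) (hg : g ∈ Subgroup.closure {u, s, e, c}) :
    Factors P u l e (x * g) := by
  have his : s⁻¹ = s := inv_eq_of_mul_eq_one_right h.ss
  have hie : e⁻¹ = e := inv_eq_of_mul_eq_one_right h.ee
  have hic : c⁻¹ = c := inv_eq_of_mul_eq_one_right h.cc
  induction hg using Subgroup.closure_induction_right with
  | one => simpa using hx
  | mul_right y _ g hg ih =>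
    rw [← mul_assoc]
    rcases hg with rfl | rfl | rfl | rfl
    exacts [(h.factors_mul_u ih).1, h.factors_mul_s hs he hc ih, h.factors_mul_e ih,
      h.factors_mul_c hc ih]
  | mul_inv_cancel y _ g hg ih =>
    rw [← mul_assoc]
    rcases hg with rfl | rfl | rfl | rfl
    · exact (h.factors_mul_u ih).2
    · rw [his]; exact h.factors_mul_s hs he hc ih
    · rw [hie]; exact h.factors_mul_e ih
    · rw [hic]; exact h.factors_mul_c hc ih

/-- Conjugation by e c inverts both transvections, and l⁻¹ = (s c) u⁻¹ (s c). -/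
theorem exists_conj_mem (h : OutRelations u l s e c) {φ : Q}
    (hφ : φ ∈ Submonoid.closure {u, l}) :
    ∃ φ' ∈ Submonoid.closure {u⁻¹, s * c}, φ * (e * c) = e * c * φ' := by
  have hcu : c * u⁻¹ = u⁻¹ * c := (show Commute c u from h.cu).inv_right
  have hcl : c * l⁻¹ = l⁻¹ * c := (show Commute c l from h.cl).inv_right
  have eu : u * e = e * u⁻¹ := by rw [eq_mul_inv_iff_mul_eq, mul_assoc, h.eu]; group
  have el : l * e = e * l⁻¹ := by rw [eq_mul_inv_iff_mul_eq, mul_assoc, h.el]; group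
  induction hφ using Submonoid.closure_induction with
  | mem x hx =>
    rcases hx with rfl | rfl
    · refine ⟨x⁻¹, Submonoid.subset_closure (by simp), ?_⟩
      rw [← mul_assoc, eu, mul_assoc, mul_assoc, hcu]
    · have hw : s * c ∈ Submonoid.closure {u⁻¹, s * c} := Submonoid.subset_closure (by simp)
      have hu : u⁻¹ ∈ Submonoid.closure {u⁻¹, s * c} := Submonoid.subset_closure (by simp)
      refine ⟨x⁻¹, ?_, ?_⟩
      · have e1 : x⁻¹ = s * c * u⁻¹ * (s * c) := by
          have h1 : SemiconjBy s u x := h.su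
          calc x⁻¹ = x⁻¹ * (s * (c * c) * s) := by rw [h.cc, mul_one, h.ss, mul_one]
            _ = s * u⁻¹ * (c * c) * s := by rw [← mul_assoc, ← mul_assoc, ← h1.inv_right.eq]
            _ = s * (c * u⁻¹) * (c * s) := by rw [hcu]; group
            _ = _ := by rw [h.cs]; group
        rw [e1]
        exact mul_mem (mul_mem hw hu) hw
      · rw [← mul_assoc, el, mul_assoc, mul_assoc, hcl]
  | one => exact ⟨1, one_mem _, by simp⟩
  | mul x y _ _ hx hy =>
    obtain ⟨x', hx', hx⟩ := hx
    obtain ⟨y', hy', hy⟩ := hy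
    exact ⟨x' * y', mul_mem hx' hy', by rw [mul_assoc, hy, ← mul_assoc, hx, mul_assoc]⟩

/-- A factorization can be rewritten with negative words in the middle. -/
theorem exists_negative_factorization (h : OutRelations u l s e c) (he : e ∈ P) (hc : c ∈ P)
    {x : Q} (hx : Factors P u l e x) :
    ∃ ψ ∈ P, ∃ φ ∈ Submonoid.closure {u⁻¹, s * c}, ∃ n : ℕ, ∃ g, (g = e * c ∨ g = c) ∧
      x = ψ * φ * u ^ n * g := by
  -- A nonnegative power of `u` is absorbed into the positive word, so only exponents -n remain.
  obtain ⟨ψ, hψ, φ, hφ, n, g, hg, rfl⟩ : ∃ ψ ∈ P, ∃ φ ∈ Submonoid.closure {u, l}, ∃ n : ℕ,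
      ∃ g, (g = 1 ∨ g = e) ∧ x = ψ * φ * u⁻¹ ^ n * g := by
    obtain ⟨ψ, hψ, φ, hφ, k, g, hg, rfl⟩ := hx
    obtain ⟨n, rfl | rfl⟩ := k.eq_nat_or_neg
    · exact ⟨ψ, hψ, φ * u ^ n, mul_mem hφ (pow_mem (Submonoid.subset_closure (by simp)) n), 0, g,
        hg, by simp [mul_assoc]⟩
    · exact ⟨ψ, hψ, φ, hφ, n, g, hg, by simp⟩
  obtain ⟨φ', hφ', e1⟩ := h.exists_conj_mem hφ
  have dd : e * c * (e * c) = 1 := by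
    rw [mul_assoc, ← mul_assoc c, h.ce, mul_assoc e c c, h.cc, mul_one, h.ee]
  have eu : SemiconjBy e u⁻¹ u := by
    have : SemiconjBy e u u⁻¹ := h.eu
    simpa using this.inv_right
  have cu : SemiconjBy c u⁻¹ u⁻¹ := (show Commute c u from h.cu).inv_right
  have e2 : (e * c) * u⁻¹ ^ n = u ^ n * (e * c) := (eu.mul_left cu).pow_right n
  -- The involution e c is inserted twice after φ: one copy moves left through φ into `P`, the other
  -- moves right through u⁻ⁿ and joins g.
  refine ⟨ψ * (e * c), mul_mem hψ (mul_mem he hc), φ', hφ', n, e * c * g, ?_, ?_⟩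
  · rcases hg with rfl | rfl
    · exact .inl (mul_one _)
    · right
      rw [mul_assoc, h.ce, ← mul_assoc, h.ee, one_mul]
  · calc ψ * φ * u⁻¹ ^ n * g = ψ * φ * (e * c * (e * c)) * u⁻¹ ^ n * g := by rw [dd, mul_one]
      _ = ψ * (φ * (e * c)) * ((e * c) * u⁻¹ ^ n) * g := by group
      _ = ψ * (e * c * φ') * (u ^ n * (e * c)) * g := by rw [e1, e2]
      _ = _ := by group

end OutRelations

end Factorization

/-! ### The elementary automorphisms of `F2`. -/

@[simp] theorem phi_a (x y : F2) : phi x y a = x := by simp [phi, a]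

@[simp] theorem phi_b (x y : F2) : phi x y b = y := by simp [phi, b]

theorem hom_ext {f g : F2 →* F2} (ha : f a = g a) (hb : f b = g b) : f = g := by
  ext i
  fin_cases i
  exacts [ha, hb]

theorem aut_ext {f g : MulAut F2} (ha : f a = g a) (hb : f b = g b) : f = g := by
  have h : f.toMonoidHom = g.toMonoidHom := hom_ext ha hb
  ext x
  exact DFunLike.congr_fun h x

/-- The automorphism with values `x`, `y` on the basis whose inverse has values `x'`, `y'`. -/
def mkAut (x y x' y' : F2) (h1 : phi x' y' x = a) (h2 : phi x' y' y = b) (h3 : phi x y x' = a)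
    (h4 : phi x y y' = b) : MulAut F2 :=
  MonoidHom.toMulEquiv (phi x y) (phi x' y') (hom_ext (by simpa using h1) (by simpa using h2))
    (hom_ext (by simpa using h3) (by simpa using h4))

@[simp] theorem mkAut_apply (x y x' y' : F2) (h1 h2 h3 h4) (g : F2) :
    mkAut x y x' y' h1 h2 h3 h4 g = phi x y g := by
  unfold mkAut
  exact congrFun (MonoidHom.toMulEquiv_apply (phi x y) (phi x' y') _ _) g

@[simp] theorem mkAut_symm_apply (x y x' y' : F2) (h1 h2 h3 h4) (g : F2) :
    (mkAut x y x' y' h1 h2 h3 h4).symm g = phi x' y' g := by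
  unfold mkAut
  exact congrFun (MonoidHom.toMulEquiv_symm_apply (phi x y) (phi x' y') _ _) g

/-- The transvection `a ↦ a`, `b ↦ b * a`. -/
def transvU : MulAut F2 := mkAut a (b * a) a (b * a⁻¹) (by simp) (by simp) (by simp) (by simp)

/-- The transvection `a ↦ a * b`, `b ↦ b`. -/
def transvL : MulAut F2 := mkAut (a * b) b (a * b⁻¹) b (by simp) (by simp) (by simp) (by simp)

/-- The automorphism exchanging `a` and `b`. -/
def swapAut : MulAut F2 := mkAut b a b a (by simp) (by simp) (by simp) (by simp)

/-- The automorphism inverting `b` and fixing `a`. -/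
def invB : MulAut F2 := mkAut a b⁻¹ a b⁻¹ (by simp) (by simp) (by simp) (by simp)

/-- The automorphism inverting `a` and `b`. -/
def invAB : MulAut F2 := mkAut a⁻¹ b⁻¹ a⁻¹ b⁻¹ (by simp) (by simp) (by simp) (by simp)

@[simp] theorem transvU_a : transvU a = a := by
  simp [transvU]
@[simp] theorem transvU_b : transvU b = b * a := by
  simp [transvU]
@[simp] theorem transvU_symm_a : transvU.symm a = a := by
  simp [transvU]
@[simp] theorem transvU_symm_b : transvU.symm b = b * a⁻¹ := by
  simp [transvU]
@[simp] theorem transvL_a : transvL a = a * b := by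
  simp [transvL]
@[simp] theorem transvL_b : transvL b = b := by
  simp [transvL]
@[simp] theorem swapAut_a : swapAut a = b := by
  simp [swapAut]
@[simp] theorem swapAut_b : swapAut b = a := by
  simp [swapAut]
@[simp] theorem invB_a : invB a = a := by
  simp [invB]
@[simp] theorem invB_b : invB b = b⁻¹ := by
  simp [invB]
@[simp] theorem invAB_a : invAB a = a⁻¹ := by
  simp [invAB]
@[simp] theorem invAB_b : invAB b = b⁻¹ := by
  simp [invAB]

theorem mem_auts {S : Set (F2 →* F2)} {θ : MulAut F2} (h : phi (θ a) (θ b) ∈ S) : θ ∈ auts S := by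
  have e : θ.toMonoidHom = phi (θ a) (θ b) := hom_ext (by simp) (by simp)
  change θ.toMonoidHom ∈ S
  rwa [e]

theorem transvU_zpow_a (k : ℤ) : (transvU ^ k) a = a := by
  induction k using Int.induction_on with
  | zero => simp
  | succ k ih => rw [zpow_add_one, MulAut.mul_apply, transvU_a, ih]
  | pred k ih => rw [zpow_sub_one, MulAut.mul_apply, MulAut.inv_apply, transvU_symm_a, ih]

theorem transvU_zpow_b (k : ℤ) : (transvU ^ k) b = b * a ^ k := by
  induction k using Int.induction_on with
  | zero => simp
  | succ k ih =>
    rw [zpow_add_one, MulAut.mul_apply, transvU_b, map_mul, ih, transvU_zpow_a]; group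
  | pred k ih =>
    rw [zpow_sub_one, MulAut.mul_apply, MulAut.inv_apply, transvU_symm_b, map_mul, map_inv, ih, transvU_zpow_a]
    group

theorem transvU_zpow_mul_mem_Delta (k : ℤ) {g : MulAut F2} (hg : g = 1 ∨ g = invB) :
    transvU ^ k * g ∈ Delta := by
  rcases hg with rfl | rfl
  · exact mem_auts ⟨0, k, 1, .inl rfl, by simp [transvU_zpow_a, transvU_zpow_b]⟩
  · exact mem_auts ⟨-k, 0, -1, .inr rfl, by simp [transvU_zpow_a, transvU_zpow_b]⟩

/-! ### Passage to `Out F2`. -/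

instance normal_range_conj : (MulAut.conj (G := F2)).range.Normal where
  conj_mem := by
    rintro _ ⟨w, rfl⟩ θ
    exact ⟨θ w, by ext x; simp⟩

/-- The outer automorphism group of `F2`. -/
abbrev OutF2 : Type := MulAut F2 ⧸ (MulAut.conj (G := F2)).range

/-- The projection of `Aut F2` onto `Out F2`. -/
abbrev toOut : MulAut F2 →* OutF2 := QuotientGroup.mk' _

theorem mem_Lam_of_toOut_eq {θ η : MulAut F2} (h : toOut θ = toOut η) : θ * η⁻¹ ∈ Lam := by
  have h1 : θ * η⁻¹ ∈ (MulAut.conj (G := F2)).range := by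
    rw [← QuotientGroup.eq_one_iff]
    change toOut (θ * η⁻¹) = 1
    rw [map_mul, map_inv, h, mul_inv_cancel]
  obtain ⟨w, hw⟩ := h1
  exact ⟨w⁻¹, by rw [lam, inv_inv, hw]⟩

theorem toOut_conj_mul (w : F2) (θ : MulAut F2) : toOut (MulAut.conj w * θ) = toOut θ := by
  have : toOut (MulAut.conj w) = 1 := (QuotientGroup.eq_one_iff _).mpr ⟨w, rfl⟩
  rw [map_mul, this, one_mul]

/-- Only `cu`, `eu` and `lu` need a correction, conjugation by `a` or its inverse; the other
relations are checked in `MulAut F2` itself. -/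
theorem outRelations : OutRelations (toOut transvU) (toOut transvL) (toOut swapAut) (toOut invB)
    (toOut invAB) where
  ss := by rw [← map_mul, ← map_one toOut]; congr 1; apply aut_ext <;> simp
  ee := by rw [← map_mul, ← map_one toOut]; congr 1; apply aut_ext <;> simp
  cc := by rw [← map_mul, ← map_one toOut]; congr 1; apply aut_ext <;> simp
  cu := by
    rw [← map_mul, ← map_mul, ← toOut_conj_mul a⁻¹]
    congr 1; apply aut_ext <;> simp [mul_assoc]
  cs := by rw [← map_mul, ← map_mul]; congr 1; apply aut_ext <;> simp
  ce := by rw [← map_mul, ← map_mul]; congr 1; apply aut_ext <;> simp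
  se := by rw [← map_mul, ← map_mul, ← map_mul]; congr 1; apply aut_ext <;> simp
  su := by rw [← map_mul, ← map_mul]; congr 1; apply aut_ext <;> simp
  eu := by
    rw [← map_inv, ← map_mul, ← map_mul, ← toOut_conj_mul a]
    congr 1; apply aut_ext <;> simp [mul_assoc]
  lu := by
    rw [← map_inv, ← map_mul, ← map_mul, ← map_mul, ← toOut_conj_mul a (_ * (_ * _))]
    congr 1; apply aut_ext <;> simp [mul_assoc]

/-! ### Letters, the monoid `Psi`, and generation of `Out F2`. -/

theorem exists_eq_letter {g : F2} (h : g.norm = 1) : ∃ l, g = letter l := by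
  obtain ⟨l, hl⟩ := List.length_eq_one_iff.mp (show g.toWord.length = 1 from h)
  exact ⟨l, by rw [letter, ← hl, FreeGroup.mk_toWord]⟩

theorem letter_cases (l : Fin 2 × Bool) :
    letter l = a ∨ letter l = a⁻¹ ∨ letter l = b ∨ letter l = b⁻¹ := by
  obtain ⟨i, x⟩ := l
  fin_cases i <;> cases x <;> simp [letter, a, b, FreeGroup.of, FreeGroup.invRev]

theorem norm_apply_letter {θ : MulAut F2} (hθ : θ ∈ Psi) (l : Fin 2 × Bool) :
    (θ (letter l)).norm = 1 := by
  rcases letter_cases l with h | h | h | h <;> rw [h]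
  · exact hθ.1
  · rw [map_inv, FreeGroup.norm_inv_eq, hθ.1]
  · exact hθ.2
  · rw [map_inv, FreeGroup.norm_inv_eq, hθ.2]

/-- `Psi` as a submonoid. -/
def PsiSubmonoid : Submonoid (MulAut F2) where
  carrier := Psi
  one_mem' := ⟨FreeGroup.norm_of 0, FreeGroup.norm_of 1⟩
  mul_mem' := by
    intro θ η hθ hη
    obtain ⟨l, hl⟩ := exists_eq_letter hη.1
    obtain ⟨m, hm⟩ := exists_eq_letter hη.2
    constructor
    · rw [MulAut.mul_apply, hl, norm_apply_letter hθ]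
    · rw [MulAut.mul_apply, hm, norm_apply_letter hθ]

theorem norm_a : a.norm = 1 := FreeGroup.norm_of 0

theorem norm_b : b.norm = 1 := FreeGroup.norm_of 1

theorem swapAut_mem_Psi : swapAut ∈ Psi := by simp [Psi, norm_a, norm_b]

theorem invB_mem_Psi : invB ∈ Psi := by simp [Psi, norm_a, norm_b]

theorem invAB_mem_Psi : invAB ∈ Psi := by simp [Psi, norm_a, norm_b]

/-- Any two letters with distinct underlying generators are the images of `a` and `b` under an
element of the group generated by the swap and the inversions. -/
theorem exists_apply_eq_letters (l m : Fin 2 × Bool) (h : l.1 ≠ m.1) :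
    ∃ g ∈ Subgroup.closure {transvU, swapAut, invB, invAB}, g a = letter l ∧ g b = letter m := by
  have hs : swapAut ∈ Subgroup.closure {transvU, swapAut, invB, invAB} :=
    Subgroup.subset_closure (by simp)
  have he : invB ∈ Subgroup.closure {transvU, swapAut, invB, invAB} :=
    Subgroup.subset_closure (by simp)
  have hc : invAB ∈ Subgroup.closure {transvU, swapAut, invB, invAB} :=
    Subgroup.subset_closure (by simp)
  have signs : ∀ x y : Bool, ∃ g ∈ Subgroup.closure {transvU, swapAut, invB, invAB},
      g a = letter (0, x) ∧ g b = letter (1, y) := by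
    have h0 : letter (0, true) = a := rfl
    have h1 : letter (1, true) = b := rfl
    have h2 : letter (0, false) = a⁻¹ := by simp [letter, a, FreeGroup.of, FreeGroup.invRev]
    have h3 : letter (1, false) = b⁻¹ := by simp [letter, b, FreeGroup.of, FreeGroup.invRev]
    intro x y
    cases x <;> cases y
    · exact ⟨invAB, hc, by simp [h2], by simp [h3]⟩
    · exact ⟨invAB * invB, mul_mem hc he, by simp [h2], by simp [h1]⟩
    · exact ⟨invB, he, by simp [h0], by simp [h3]⟩
    · exact ⟨1, one_mem _, by simp [h0], by simp [h1]⟩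
  have hswap : ∀ x, swapAut (letter (0, x)) = letter (1, x) ∧
      swapAut (letter (1, x)) = letter (0, x) := by
    have h0 : letter (0, true) = a := rfl
    have h1 : letter (1, true) = b := rfl
    have h2 : letter (0, false) = a⁻¹ := by simp [letter, a, FreeGroup.of, FreeGroup.invRev]
    have h3 : letter (1, false) = b⁻¹ := by simp [letter, b, FreeGroup.of, FreeGroup.invRev]
    intro x
    cases x <;> simp [h0, h1, h2, h3]
  obtain ⟨i, x⟩ := l
  obtain ⟨j, y⟩ := m
  have hij : (i = 0 ∧ j = 1) ∨ (i = 1 ∧ j = 0) := by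
    change i ≠ j at h
    omega
  rcases hij with ⟨rfl, rfl⟩ | ⟨rfl, rfl⟩
  · exact signs x y
  · obtain ⟨g, hg, ha, hb⟩ := signs x y
    exact ⟨swapAut * g, mul_mem hs hg, by rw [MulAut.mul_apply, ha, (hswap x).1],
      by rw [MulAut.mul_apply, hb, (hswap y).2]⟩

theorem norm_apply_letters (θ : MulAut F2) (l m : Fin 2 × Bool) (h : l.1 ≠ m.1) :
    (θ (letter l)).norm + (θ (letter m)).norm = (θ a).norm + (θ b).norm := by
  have hn : ∀ k : Fin 2 × Bool, (θ (letter k)).norm = (θ (FreeGroup.of k.1)).norm := by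
    rintro ⟨i, x⟩
    cases x
    · have : letter (i, false) = (FreeGroup.of i)⁻¹ := by
        simp [letter, FreeGroup.of, FreeGroup.invRev]
      rw [this, map_inv, FreeGroup.norm_inv_eq]
    · rfl
  rw [hn, hn]
  have hij : (l.1 = 0 ∧ m.1 = 1) ∨ (l.1 = 1 ∧ m.1 = 0) := by omega
  rcases hij with ⟨h1, h2⟩ | ⟨h1, h2⟩ <;> rw [h1, h2]
  · rfl
  · exact add_comm _ _

/-- Modulo inner automorphisms, every automorphism is a product of an element of `Psi` and an
element of the group generated by the elementary automorphisms. -/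
theorem exists_toOut_eq (θ : MulAut F2) : ∃ ψ ∈ Psi,
    ∃ g ∈ Subgroup.closure {transvU, swapAut, invB, invAB}, toOut θ = toOut (ψ * g) := by
  induction hN : (θ a).norm + (θ b).norm using Nat.strong_induction_on generalizing θ with
  | _ N ih =>
    by_cases hmin : ∀ l m : Fin 2 × Bool, l.1 ≠ m.1 → ∀ c : F2,
      (θ (letter l)).norm + (θ (letter m)).norm ≤
        (c * θ (letter l) * c⁻¹).norm + (c * (θ (letter m) * θ (letter l)) * c⁻¹).norm
    · exact ⟨θ, mem_Psi_of_minimal θ hmin, 1, one_mem _, by rw [mul_one]⟩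
    · push Not at hmin
      obtain ⟨l, m, hlm, c, hlt⟩ := hmin
      obtain ⟨g, hg, ha, hb⟩ := exists_apply_eq_letters l m hlm
      rw [norm_apply_letters θ l m hlm, hN] at hlt
      have hu : transvU ∈ Subgroup.closure {transvU, swapAut, invB, invAB} :=
        Subgroup.subset_closure (by simp)
      -- Precomposing with `g * transvU` makes the basis images θ(l) and θ(m)θ(l), so this
      -- automorphism realizes the shortening move.
      obtain ⟨ψ, hψ, k, hk, e⟩ := ih _ hlt (MulAut.conj c * (θ * g * transvU))
        (by simp [ha, hb])
      refine ⟨ψ, hψ, k * (g * transvU)⁻¹, mul_mem hk (inv_mem (mul_mem hg hu)), ?_⟩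
      rw [toOut_conj_mul] at e
      rw [← mul_assoc, map_mul _ (ψ * k), ← e, ← map_mul]
      congr 1
      group

theorem factors_toOut (θ : MulAut F2) :
    Factors (PsiSubmonoid.map toOut) (toOut transvU) (toOut transvL) (toOut invB) (toOut θ) := by
  obtain ⟨ψ, hψ, g, hg, e⟩ := exists_toOut_eq θ
  have mem : ∀ η ∈ Psi, toOut η ∈ PsiSubmonoid.map toOut := fun η hη => ⟨η, hη, rfl⟩
  have hg' : toOut g ∈
      Subgroup.closure {toOut transvU, toOut swapAut, toOut invB, toOut invAB} := by
    have := Subgroup.mem_map_of_mem toOut hg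
    rw [MonoidHom.map_closure] at this
    simpa [Set.image_insert_eq] using this
  rw [e, map_mul]
  refine outRelations.factors_mul (mem _ swapAut_mem_Psi) (mem _ invB_mem_Psi)
    (mem _ invAB_mem_Psi) ?_ hg'
  simpa using OutRelations.factors_mul_left (mem ψ hψ)
    (OutRelations.factors_of_mem (u := toOut transvU) (l := toOut transvL) (e := toOut invB)
      (one_mem _))

theorem exists_mem_closure_pair {G H : Type*} [Group G] [Group H] (f : G →* H) {x y : G} {h : H}
    (hh : h ∈ Submonoid.closure {f x, f y}) : ∃ g ∈ Submonoid.closure {x, y}, f g = h := by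
  have e : ({f x, f y} : Set H) = f '' {x, y} := by rw [Set.image_pair]
  rw [e, ← MonoidHom.map_mclosure] at hh
  exact hh

/-! ### The two factorizations of the automorphism group. -/

theorem univ_eq_Lam_Psi_Phi_Delta :
    (Set.univ : Set (MulAut F2)) = Lam * Psi * star Phi * Delta := by
  refine (Set.eq_univ_of_forall fun θ => ?_).symm
  obtain ⟨_, ⟨ψ, hψ, rfl⟩, φ', hφ', k, g', hg', e⟩ := factors_toOut θ
  obtain ⟨φ, hφ, rfl⟩ := exists_mem_closure_pair toOut hφ'
  obtain ⟨g, hg, rfl⟩ : ∃ g, (g = 1 ∨ g = invB) ∧ toOut g = g' := by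
    rcases hg' with rfl | rfl
    exacts [⟨1, .inl rfl, map_one _⟩, ⟨invB, .inr rfl, rfl⟩]
  rw [← map_zpow, ← map_mul, ← map_mul, ← map_mul] at e
  have hPhi : φ ∈ star Phi := by
    refine Submonoid.closure_mono ?_ hφ
    rintro _ (rfl | rfl)
    · exact mem_auts (by simp)
    · exact mem_auts (by simp)
  refine ⟨_, ⟨_, ⟨_, mem_Lam_of_toOut_eq e, ψ, hψ, rfl⟩, φ, hPhi, rfl⟩, _,
    transvU_zpow_mul_mem_Delta k hg, ?_⟩
  simp only
  group

theorem univ_eq_Psi_Sigma0_Lam :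
    (Set.univ : Set (MulAut F2)) = Psi * star (Sigma0⁻¹) * Lam * star (auts {phi a (b * a)}) *
      (auts {phi a⁻¹ b} ∪ auts {phi a⁻¹ b⁻¹}) := by
  refine (Set.eq_univ_of_forall fun θ => ?_).symm
  have mem : ∀ η ∈ Psi, toOut η ∈ PsiSubmonoid.map toOut := fun η hη => ⟨η, hη, rfl⟩
  obtain ⟨_, ⟨ψ, hψ, rfl⟩, φ', hφ', n, g', hg', e⟩ :=
    outRelations.exists_negative_factorization (mem _ invB_mem_Psi) (mem _ invAB_mem_Psi)
      (factors_toOut θ)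
  rw [← map_inv, ← map_mul] at hφ'
  obtain ⟨φ, hφ, rfl⟩ := exists_mem_closure_pair toOut hφ'
  obtain ⟨g, hg, rfl⟩ : ∃ g, (g = invB * invAB ∨ g = invAB) ∧ toOut g = g' := by
    rcases hg' with rfl | rfl
    exacts [⟨invB * invAB, .inl rfl, map_mul _ _ _⟩, ⟨invAB, .inr rfl, rfl⟩]
  have hSigma : φ ∈ star (Sigma0⁻¹) := by
    refine Submonoid.closure_mono ?_ hφ
    rintro _ (rfl | rfl)
    · exact Set.inv_mem_inv.mpr (mem_auts (by simp))
    -- This is φ with values b⁻¹, a⁻¹; being an involution, it belongs to the inverse of `Sigma0` as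
    -- well.
    · have : (swapAut * invAB)⁻¹ = swapAut * invAB :=
        inv_eq_of_mul_eq_one_right (aut_ext (by simp) (by simp))
      rw [Set.mem_inv, this]
      exact mem_auts (by simp)
  have hu : transvU ^ n ∈ star (auts {phi a (b * a)}) :=
    pow_mem (Submonoid.subset_closure (mem_auts (by simp))) n
  have hg2 : g ∈ auts {phi a⁻¹ b} ∪ auts {phi a⁻¹ b⁻¹} := by
    rcases hg with rfl | rfl
    · exact .inl (mem_auts (by simp))
    · exact .inr (mem_auts (by simp))
  -- The inner discrepancy is isolated between `φ` and the power of `transvU`, where `Lam` stands in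
  -- the product.
  have hL : (ψ * φ)⁻¹ * θ * (transvU ^ n * g)⁻¹ ∈ Lam := by
    have h1 : toOut ((ψ * φ)⁻¹ * θ) = toOut (transvU ^ n * g) := by
      simp only [map_mul, map_inv, map_pow, e]
      group
    exact mem_Lam_of_toOut_eq h1
  refine ⟨_, ⟨_, ⟨_, ⟨ψ, hψ, φ, hSigma, rfl⟩, _, hL, rfl⟩, _, hu, rfl⟩, g, hg2, ?_⟩
  simp only
  group

end AutF2

theorem mainTheorem7 :
    (Set.univ : Set (MulAut AutF2.F2)) =
        AutF2.Lam * AutF2.Psi * AutF2.star AutF2.Phi * AutF2.Delta ∧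
    (Set.univ : Set (MulAut AutF2.F2)) =
        AutF2.Psi * AutF2.star (AutF2.Sigma0⁻¹) * AutF2.Lam *
          AutF2.star (AutF2.auts {AutF2.phi AutF2.a (AutF2.b * AutF2.a)}) *
          (AutF2.auts {AutF2.phi AutF2.a⁻¹ AutF2.b} ∪
            AutF2.auts {AutF2.phi AutF2.a⁻¹ AutF2.b⁻¹}) :=
  ⟨AutF2.univ_eq_Lam_Psi_Phi_Delta, AutF2.univ_eq_Psi_Sigma0_Lam⟩
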